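/- Let $R=\mathbb Z[u,v,w,x,y,z]$ be the polynomial ring in six variables over the integers, and let $$\Delta_1=vz-wy,\qquad \Delta_2=wx-uz,\qquad \Delta_3=uy-vx .$$ Let $F_1,F_2,F_3\in R$ satisfy $F_1\Delta_1+F_2\Delta_2+F_3\Delta_3=0$. Then for every prime number $p$, every prime power $q=p^e$ with $e\ge 0$, and $k=q-1$, the polynomial $(F_1\Delta_1)^q+(F_2\Delta_2)^q+(F_3\Delta_3)^q$ is divisible by $p$ in $R$, and $$\frac{(F_1\Delta_1)^q+(F_2\Delta_2)^q+(F_3\Delta_3)^q}{p}\,(\Delta_1\Delta_2\Delta_3)^{k}\in\left(\Delta_1^{q+k},\ \Delta_2^{q+k},\ \Delta_3^{q+k}\right)R .$$ -/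

import Mathlib

namespace PluckerMinors

/-- The polynomial ring `ℤ[u, v, w, x, y, z]`. -/
abbrev R : Type := MvPolynomial (Fin 6) ℤ

noncomputable section

/-- The six variables of `R`. -/
def u : R := MvPolynomial.X 0

def v : R := MvPolynomial.X 1

def w : R := MvPolynomial.X 2

def x : R := MvPolynomial.X 3

def y : R := MvPolynomial.X 4

def z : R := MvPolynomial.X 5

/-- The (signed) size two minors of the matrix with rows `(u, v, w)` and `(x, y, z)`. -/
def Δ₁ : R := v * z - w * y

def Δ₂ : R := w * x - u * z

def Δ₃ : R := u * y - v * x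

end

end PluckerMinors

/-! Write Δᵢ also as dᵢ. Syzygies of the minors are combinations of the two rows, and the mixed
terms of `(a + b)^q` are `p` times something already giving elements of the ideal, so it suffices to
treat one row (`exists_mul_eq_sum_row_pow`). For the row (x, y, z), `pL(d₁d₂d₃)^k = ∑ x^(k+1)
(d₂d₃)^k d₁^(2k+1)` lies in the ideal. It remains to put `NL(d₁d₂d₃)^k` there for some `N` prime to
`p`. This needs a syzygy of the powers `dᵢ^(2k+1)` whose coefficients, after removal of a common
integer `m`, are `N x^(k+1) (d₂d₃)^k` and its cyclic analogues modulo `p`. Such a syzygy comes from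
integrating `((t - r)(t - s)(t - c))^k` around the loop r → s → c → r (`betaForm_syzygy`). It is
applied to `dᵢ` times the entries of (x, y, z) + σ(u, v, w), which sum to zero, and the coefficient
of σᵏ is taken (`loweredForm_syzygy`). Binomial divisibilities give the congruence
(`exists_loweredForm_eq`); `p = 2` needs one more factor of 2 throughout. -/

/-! ### Beta integrals and a syzygy of (2k+1)-st powers -/

/-- The Euler beta integral at natural number arguments. -/
theorem integral_pow_mul_one_sub_pow (a b : ℕ) :
    ∫ t in (0 : ℝ)..1, t ^ a * (1 - t) ^ b =
      (a.factorial * b.factorial : ℝ) / (a + b + 1).factorial := by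
  induction b generalizing a with
  | zero => simp [Nat.factorial_succ]; field_simp
  | succ b ih =>
    have key : ∫ t in (0 : ℝ)..1, ((a + 1 : ℝ) * (t ^ a * (1 - t) ^ (b + 1))
        - (b + 1 : ℝ) * (t ^ (a + 1) * (1 - t) ^ b)) = 0 := by
      rw [intervalIntegral.integral_eq_sub_of_hasDerivAt
        (f := fun t : ℝ => t ^ (a + 1) * (1 - t) ^ (b + 1))]
      · simp
      · intro t _
        have h := (hasDerivAt_pow (a + 1) t).mul (((hasDerivAt_id t).const_sub 1).pow (b + 1))
        refine h.congr_deriv ?_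
        simp
        ring
      · exact Continuous.intervalIntegrable (by fun_prop) _ _
    rw [intervalIntegral.integral_sub (Continuous.intervalIntegrable (by fun_prop) _ _)
      (Continuous.intervalIntegrable (by fun_prop) _ _),
      intervalIntegral.integral_const_mul, intervalIntegral.integral_const_mul, ih] at key
    have ha : (a + 1 : ℝ) ≠ 0 := by positivity
    refine mul_left_cancel₀ ha ?_
    rw [sub_eq_zero.mp key, show a + (b + 1) + 1 = a + 1 + b + 1 by ring,
      Nat.factorial_succ a, Nat.factorial_succ b]
    push_cast
    ring

/-- The binary form `∑ (-1)ʲ C(k+j,k) C(2k-j,k) aʲ bᵏ⁻ʲ`, a multiple of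
`∫ tᵏ(1-t)ᵏ((1-t)b - ta)ᵏ dt` over the unit interval. -/
def betaForm {S : Type*} [CommRing S] (k : ℕ) (a b : S) : S :=
  ∑ j ∈ Finset.range (k + 1),
    (-1) ^ j * (((k + j).choose k * (2 * k - j).choose k : ℕ) : S) * a ^ j * b ^ (k - j)

theorem map_betaForm {S T : Type*} [CommRing S] [CommRing T] (φ : S →+* T) (k : ℕ) (a b : S) :
    φ (betaForm k a b) = betaForm k (φ a) (φ b) := by
  simp [betaForm, map_sum]

theorem choose_mul_factorial_mul_factorial (k j : ℕ) (hj : j ≤ k) :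
    k.choose j * ((k + j).factorial * (2 * k - j).factorial) =
      k.factorial ^ 3 * ((k + j).choose k * (2 * k - j).choose k) := by
  have h1 := Nat.choose_mul_factorial_mul_factorial hj
  have h2 := Nat.choose_mul_factorial_mul_factorial (Nat.le_add_right k j)
  have h3 := Nat.choose_mul_factorial_mul_factorial (show k ≤ 2 * k - j by omega)
  rw [show k + j - k = j by omega] at h2
  rw [show 2 * k - j - k = k - j by omega] at h3
  rw [← h2, ← h3]
  calc _ = (k.choose j * j.factorial * (k - j).factorial) *
        (((k + j).choose k * (2 * k - j).choose k) * k.factorial ^ 2) := by ring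
    _ = _ := by rw [h1]; ring

theorem integral_eq_betaForm (k : ℕ) (a b : ℝ) :
    ∫ t in (0 : ℝ)..1, t ^ k * (1 - t) ^ k * ((1 - t) * b - t * a) ^ k =
      (k.factorial ^ 3 : ℝ) / (3 * k + 1).factorial * betaForm k a b := by
  have h (t : ℝ) : t ^ k * (1 - t) ^ k * ((1 - t) * b - t * a) ^ k =
      ∑ j ∈ Finset.range (k + 1), ((-1) ^ j * k.choose j * a ^ j * b ^ (k - j)) *
        (t ^ (k + j) * (1 - t) ^ (2 * k - j)) := by
    rw [show (1 - t) * b - t * a = -(t * a) + (1 - t) * b by ring, add_pow, Finset.mul_sum]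
    refine Finset.sum_congr rfl fun j hj => ?_
    have hj : j ≤ k := Nat.lt_succ_iff.mp (Finset.mem_range.mp hj)
    rw [show 2 * k - j = k + (k - j) by omega, neg_pow, mul_pow, mul_pow, pow_add, pow_add]
    ring
  simp_rw [h]
  rw [intervalIntegral.integral_finsetSum
    fun j _ => Continuous.intervalIntegrable (by fun_prop) _ _, betaForm, Finset.mul_sum]
  refine Finset.sum_congr rfl fun j hj => ?_
  have hj : j ≤ k := Nat.lt_succ_iff.mp (Finset.mem_range.mp hj)
  rw [intervalIntegral.integral_const_mul, integral_pow_mul_one_sub_pow,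
    show k + j + (2 * k - j) + 1 = 3 * k + 1 by omega]
  have := congrArg (Nat.cast (R := ℝ)) (choose_mul_factorial_mul_factorial k j hj)
  push_cast at this ⊢
  linear_combination ((-1) ^ j * a ^ j * b ^ (k - j) / (3 * k + 1).factorial : ℝ) * this

theorem integral_eq_sub_pow_mul_betaForm (k : ℕ) (r s c : ℝ) :
    ∫ t in r..s, ((t - r) * (t - s) * (t - c)) ^ k =
      (-1) ^ k * (k.factorial ^ 3 : ℝ) / (3 * k + 1).factorial *
        ((s - r) ^ (2 * k + 1) * betaForm k (c - s) (r - c)) := by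
  have h := intervalIntegral.smul_integral_comp_mul_add (a := 0) (b := 1)
    (fun t => ((t - r) * (t - s) * (t - c)) ^ k) (s - r) r
  rw [mul_zero, zero_add, mul_one, sub_add_cancel] at h
  have h2 (t : ℝ) : (((s - r) * t + r - r) * ((s - r) * t + r - s) * ((s - r) * t + r - c)) ^ k =
      ((-1) ^ k * (s - r) ^ (2 * k)) *
        (t ^ k * (1 - t) ^ k * ((1 - t) * (r - c) - t * (c - s)) ^ k) := by
    rw [pow_mul, ← mul_pow, ← mul_pow, ← mul_pow, ← mul_pow]
    congr 1
    ring
  rw [← h]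
  simp_rw [h2]
  rw [intervalIntegral.integral_const_mul, integral_eq_betaForm, smul_eq_mul]
  ring

/-- The nodes 0, c, -b have successive differences c, a, b, and the three integrals of one
polynomial around this loop cancel. -/
theorem betaForm_syzygy_real (k : ℕ) {a b c : ℝ} (h : a + b + c = 0) :
    c ^ (2 * k + 1) * betaForm k a b + a ^ (2 * k + 1) * betaForm k b c
      + b ^ (2 * k + 1) * betaForm k c a = 0 := by
  have hi (r s : ℝ) : IntervalIntegrable (fun t : ℝ => ((t - 0) * (t - c) * (t + b)) ^ k)
      MeasureTheory.volume r s := Continuous.intervalIntegrable (by fun_prop) _ _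
  have h1 := integral_eq_sub_pow_mul_betaForm k 0 c (-b)
  have h2 := integral_eq_sub_pow_mul_betaForm k c (-b) 0
  have h3 := integral_eq_sub_pow_mul_betaForm k (-b) 0 c
  have e := intervalIntegral.integral_add_adjacent_intervals (hi 0 c) (hi c (-b))
  have e' := intervalIntegral.integral_add_adjacent_intervals (hi 0 (-b)) (hi (-b) 0)
  rw [intervalIntegral.integral_same] at e'
  rw [← e] at e'
  have g1 : ∀ t : ℝ, ((t - 0) * (t - c) * (t - -b)) = ((t - 0) * (t - c) * (t + b)) := by
    intro t; ring
  have g2 : ∀ t : ℝ, ((t - c) * (t - -b) * (t - 0)) = ((t - 0) * (t - c) * (t + b)) := by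
    intro t; ring
  have g3 : ∀ t : ℝ, ((t - -b) * (t - 0) * (t - c)) = ((t - 0) * (t - c) * (t + b)) := by
    intro t; ring
  simp_rw [g1] at h1
  simp_rw [g2] at h2
  simp_rw [g3] at h3
  rw [h1, h2, h3] at e'
  obtain rfl : a = -b - c := by linarith
  simp only [sub_zero, sub_neg_eq_add, zero_add] at e'
  have hc : (-1) ^ k * (k.factorial ^ 3 : ℝ) / (3 * k + 1).factorial ≠ 0 := by
    have := Nat.factorial_ne_zero k
    have := Nat.factorial_ne_zero (3 * k + 1)
    simp [*]
  refine mul_left_cancel₀ hc ?_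
  rw [mul_zero, ← e']
  ring

theorem betaForm_syzygy {S : Type*} [CommRing S] (k : ℕ) {a b c : S} (h : a + b + c = 0) :
    c ^ (2 * k + 1) * betaForm k a b + a ^ (2 * k + 1) * betaForm k b c
      + b ^ (2 * k + 1) * betaForm k c a = 0 := by
  obtain rfl : c = -a - b := by linear_combination h
  -- The identity is universal: it is checked in ℤ[A, B] at all real points, then specialised to
  -- `S`.
  let A : MvPolynomial (Fin 2) ℤ := MvPolynomial.X 0
  let B : MvPolynomial (Fin 2) ℤ := MvPolynomial.X 1
  have key : (-A - B) ^ (2 * k + 1) * betaForm k A B + A ^ (2 * k + 1) * betaForm k B (-A - B)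
      + B ^ (2 * k + 1) * betaForm k (-A - B) A = 0 := by
    apply MvPolynomial.map_injective (Int.castRingHom ℝ) (RingHom.injective_int _)
    apply MvPolynomial.funext
    intro x
    simp only [map_add, map_mul, map_pow, map_betaForm, map_sub, map_neg, map_zero]
    exact betaForm_syzygy_real k (by ring)
  have := congrArg (MvPolynomial.eval₂Hom (Int.castRingHom S) ![a, b]) key
  simp only [map_add, map_mul, map_pow, map_betaForm, map_sub, map_neg, map_zero] at this
  simpa [A, B] using this

/-! ### Divisibility of binomial coefficients by powers of p -/

theorem mul_choose_add (k j : ℕ) : j * (k + j).choose k = (k + 1) * (k + j).choose (k + 1) := by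
  have := Nat.choose_succ_right_eq (k + j) k
  rw [Nat.add_sub_cancel_left] at this
  linarith

theorem Nat.Prime.dvd_of_pow_dvd_mul {p : ℕ} (hp : p.Prime) {a j b : ℕ} (h : p ^ a ∣ j * b)
    (hj : 0 < j) (hja : j < p ^ a) : p ∣ b := by
  by_contra hb
  have : (p ^ a).Coprime b := Nat.Coprime.pow_left a ((hp.coprime_iff_not_dvd).mpr hb)
  exact absurd (Nat.le_of_dvd hj (this.dvd_of_dvd_mul_right h)) (by omega)

theorem two_pow_dvd_of_not_four_dvd {a j b : ℕ} (h : 2 ^ (a + 1) ∣ j * b) (hb : ¬ 4 ∣ b) :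
    2 ^ a ∣ j := by
  by_cases h2 : 2 ∣ b
  · obtain ⟨c, rfl⟩ := h2
    have hc : ¬ 2 ∣ c := fun ⟨d, hd⟩ => hb ⟨d, by omega⟩
    rw [pow_succ', mul_left_comm] at h
    have h' := Nat.dvd_of_mul_dvd_mul_left two_pos h
    exact (Nat.Coprime.pow_left a
      ((Nat.prime_two.coprime_iff_not_dvd).mpr hc)).dvd_of_dvd_mul_right h'
  · have := (Nat.Coprime.pow_left (a + 1)
      ((Nat.prime_two.coprime_iff_not_dvd).mpr h2)).dvd_of_dvd_mul_right h
    exact (pow_dvd_pow 2 (Nat.le_succ a)).trans this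

section choose

variable {p e k : ℕ}

theorem pow_dvd_mul_choose_add (hk : k + 1 = p ^ e) (j : ℕ) : p ^ e ∣ j * (k + j).choose k :=
  ⟨_, hk ▸ mul_choose_add k j⟩

theorem prime_dvd_choose_add (hp : p.Prime) (hk : k + 1 = p ^ e) {j : ℕ} (hj : 0 < j)
    (hjk : j ≤ k) : p ∣ (k + j).choose k :=
  hp.dvd_of_pow_dvd_mul (pow_dvd_mul_choose_add hk j) hj (by omega)

theorem pow_dvd_choose_add (hp : p.Prime) (hk : k + 1 = p ^ e) {j : ℕ} (hj : ¬ p ∣ j) :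
    p ^ e ∣ (k + j).choose k :=
  (Nat.Coprime.pow_left e ((hp.coprime_iff_not_dvd).mpr hj)).dvd_of_dvd_mul_left
    (pow_dvd_mul_choose_add hk j)

/-- The two numbers sum to `k`, which is -1 modulo `p`. So one of the two binomial factors carries
all of `p ^ e`. -/
theorem not_dvd_or_not_dvd_sub (hp : p.Prime) (he : e ≠ 0) (hk : k + 1 = p ^ e) {j : ℕ}
    (hjk : j ≤ k) : ¬ p ∣ j ∨ ¬ p ∣ k - j := by
  by_contra! h
  have h1 : p ∣ j + (k - j) := dvd_add h.1 h.2
  have h2 : p ∣ k + 1 := hk ▸ dvd_pow_self p he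
  rw [show j + (k - j) = k by omega] at h1
  exact hp.one_lt.ne' (Nat.dvd_one.mp ((Nat.dvd_add_right h1).mp h2))

theorem pow_mul_dvd_choose_mul_choose (hp : p.Prime) (he : e ≠ 0) (hk : k + 1 = p ^ e) {j : ℕ}
    (hj : 0 < j) (hjk : j < k) :
    p ^ e * p ∣ (k + j).choose k * (2 * k - j).choose k := by
  rw [show 2 * k - j = k + (k - j) by omega]
  rcases not_dvd_or_not_dvd_sub hp he hk hjk.le with h | h
  · exact mul_dvd_mul (pow_dvd_choose_add hp hk h)
      (prime_dvd_choose_add hp hk (by omega) (by omega))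
  · rw [mul_comm]
    exact mul_dvd_mul (prime_dvd_choose_add hp hk hj hjk.le) (pow_dvd_choose_add hp hk h)

theorem eq_of_two_pow_dvd {a j : ℕ} (h : 2 ^ a ∣ j) (hj : 0 < j) (hja : j < 2 ^ (a + 1)) :
    j = 2 ^ a := by
  obtain ⟨c, rfl⟩ := h
  rw [pow_succ] at hja
  have h1 : c < 2 := lt_of_mul_lt_mul_left hja (Nat.zero_le _)
  have h2 : c ≠ 0 := by rintro rfl; simp at hj
  obtain rfl : c = 1 := by omega
  rw [mul_one]

theorem two_pow_mul_four_dvd_choose_mul_choose {a k : ℕ} (hk : k + 1 = 2 ^ (a + 1)) {j : ℕ}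
    (hj : 0 < j) (hjk : j < k) (h1 : j ≠ 2 ^ a) (h2 : j + 1 ≠ 2 ^ a) :
    2 ^ (a + 1) * 4 ∣ (k + j).choose k * (2 * k - j).choose k := by
  rw [show 2 * k - j = k + (k - j) by omega]
  have key {i : ℕ} (hi : 0 < i) (hik : i < k) (hia : i ≠ 2 ^ a) : 4 ∣ (k + i).choose k := by
    by_contra h
    exact hia (eq_of_two_pow_dvd (two_pow_dvd_of_not_four_dvd (pow_dvd_mul_choose_add hk i) h)
      hi (by omega))
  rcases not_dvd_or_not_dvd_sub Nat.prime_two (Nat.succ_ne_zero a) hk hjk.le with h | h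
  · refine mul_dvd_mul (pow_dvd_choose_add Nat.prime_two hk h) (key (by omega) (by omega) ?_)
    rw [pow_succ] at hk
    omega
  · rw [mul_comm]
    exact mul_dvd_mul (key hj hjk h1) (pow_dvd_choose_add Nat.prime_two hk h)

theorem pow_dvd_mul_choose_two_mul_add (hk : k + 1 = p ^ e) (m : ℕ) :
    2 * p ^ e ∣ m * (2 * k + 1 + m).choose m := by
  refine ⟨(2 * k + 1 + m).choose (2 * k + 2), ?_⟩
  rw [← Nat.choose_symm_add, mul_choose_add, ← hk]
  ring

theorem prime_dvd_choose_two_mul_add (hp : p.Prime) (hk : k + 1 = p ^ e) {m : ℕ} (hm : 0 < m)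
    (hmk : m ≤ k) : p ∣ (2 * k + 1 + m).choose m :=
  hp.dvd_of_pow_dvd_mul ((Dvd.intro_left 2 rfl).trans (pow_dvd_mul_choose_two_mul_add hk m)) hm
    (by omega)

theorem four_dvd_choose_two_mul_add (hk : k + 1 = 2 ^ e) {m : ℕ} (hm : 0 < m)
    (hmk : m ≤ k) : 4 ∣ (2 * k + 1 + m).choose m := by
  by_contra h
  have h1 := pow_dvd_mul_choose_two_mul_add hk m
  rw [← pow_succ'] at h1
  exact absurd (Nat.le_of_dvd hm (two_pow_dvd_of_not_four_dvd h1 h)) (by omega)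

/-- If `p ∣ c`, Pascal's rule would make `(2 * k + 1).choose (k + 1)` divisible by `p`; but modulo
`p` it is the coefficient of X^q in (X^q + 1)(X + 1)^k, where q = k + 1, namely 1. -/
theorem exists_choose_two_mul_eq (hp : p.Prime) (he : e ≠ 0) (hk : k + 1 = p ^ e) :
    ∃ c, (2 * k).choose k = p ^ e * c ∧ ¬ p ∣ c := by
  have hk0 : k ≠ 0 := by
    rintro rfl
    exact (Nat.one_lt_pow he hp.one_lt).ne hk
  have hpk : ¬ p ∣ k := by
    simpa using not_dvd_or_not_dvd_sub hp he hk (Nat.zero_le k)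
  obtain ⟨c, hc⟩ := pow_dvd_choose_add hp hk hpk
  rw [← two_mul] at hc
  refine ⟨c, hc, fun hpc => ?_⟩
  have h1 : k * c = (2 * k).choose (k + 1) := by
    have := mul_choose_add k k
    rw [← two_mul, hc, hk, mul_left_comm] at this
    rw [hk]
    exact Nat.eq_of_mul_eq_mul_left (pow_pos hp.pos e) this
  have h2 : p ∣ (2 * k + 1).choose (k + 1) := by
    rw [Nat.choose_succ_succ, ← h1, hc]
    exact dvd_add ((dvd_pow_self p he).mul_right c) (hpc.mul_left k)
  have := Fact.mk hp
  have h3 : ((2 * k + 1).choose (k + 1) : ZMod p) = 1 := by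
    rw [← Polynomial.coeff_X_add_one_pow, show 2 * k + 1 = (k + 1) + k by ring, pow_add, hk,
      add_pow_char_pow, one_pow, add_mul, Polynomial.coeff_add, one_mul, ← hk,
      Polynomial.coeff_X_add_one_pow, Nat.choose_succ_self,
      Polynomial.coeff_X_pow_mul', if_pos le_rfl, Nat.sub_self, Polynomial.coeff_X_add_one_pow]
    simp
  rw [(ZMod.natCast_eq_zero_iff _ _).mpr h2] at h3
  exact zero_ne_one h3

end choose

/-! ### The coefficient of σᵏ in the extreme terms -/

section coeff

open Polynomial

variable {S : Type*} [CommRing S]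

theorem coeff_C_add_C_mul_X_pow (z w : S) (n m : ℕ) :
    ((C z + C w * X) ^ n).coeff m = n.choose m * z ^ (n - m) * w ^ m := by
  have h : (C z + C w * X) ^ n = ∑ i ∈ Finset.range (n + 1),
      C (n.choose i * z ^ (n - i) * w ^ i) * X ^ i := by
    rw [add_comm, add_pow]
    refine Finset.sum_congr rfl fun i _ => ?_
    simp only [map_mul, map_pow, map_natCast]
    ring
  rw [h, finsetSum_coeff]
  simp only [coeff_C_mul_X_pow]
  rw [Finset.sum_ite_eq]
  split_ifs with hm
  · rfl
  · rw [Nat.choose_eq_zero_of_lt (by simpa using hm)]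
    simp

theorem coeff_pow_mul_pow [IsDomain S] {z : S} (hz : z ≠ 0) (y v w : S) (k : ℕ) :
    ((C z + C w * X) ^ (2 * k + 1) * (C y + C v * X) ^ k).coeff k =
      z ^ (k + 1) * ∑ m ∈ Finset.range (k + 1),
        k.choose m * (2 * k + 1 + m).choose m * (v * z - w * y) ^ (k - m) * (w * y) ^ m := by
  refine mul_left_cancel₀ (pow_ne_zero k hz) ?_
  have h : C (z ^ k) * ((C z + C w * X) ^ (2 * k + 1) * (C y + C v * X) ^ k) =
      ∑ m ∈ Finset.range (k + 1), C (k.choose m * y ^ m * (v * z - w * y) ^ (k - m)) *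
        ((C z + C w * X) ^ (2 * k + 1 + m) * X ^ (k - m)) := by
    -- Trading `y + vσ` for `z + wσ` makes the minor appear; the factor `z ^ k` this costs is
    -- cancelled at the end.
    have h1 : C z * (C y + C v * X) = C y * (C z + C w * X) + C (v * z - w * y) * X := by
      simp only [map_sub, map_mul]
      ring
    rw [map_pow, mul_left_comm, ← mul_pow, h1, add_pow (C y * _) _ k, Finset.mul_sum]
    refine Finset.sum_congr rfl fun m _ => ?_
    simp only [map_mul, map_pow, map_natCast, mul_pow]
    ring
  rw [← coeff_C_mul, h, finsetSum_coeff, ← mul_assoc, Finset.mul_sum]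
  refine Finset.sum_congr rfl fun m hm => ?_
  have hm : m ≤ k := Nat.lt_succ_iff.mp (Finset.mem_range.mp hm)
  rw [coeff_C_mul, coeff_mul_X_pow', if_pos (Nat.sub_le _ _), Nat.sub_sub_self hm,
    coeff_C_add_C_mul_X_pow, Nat.add_sub_cancel]
  ring

theorem exists_coeff_pow_mul_pow_eq [IsDomain S] {z : S} (hz : z ≠ 0) (y v w : S) {k M : ℕ}
    (hM : ∀ m, 0 < m → m ≤ k → M ∣ (2 * k + 1 + m).choose m) :
    ∃ H, ((C z + C w * X) ^ (2 * k + 1) * (C y + C v * X) ^ k).coeff k =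
      z ^ (k + 1) * (v * z - w * y) ^ k + M * H := by
  suffices h : (M : S) ∣ ((C z + C w * X) ^ (2 * k + 1) * (C y + C v * X) ^ k).coeff k -
      z ^ (k + 1) * (v * z - w * y) ^ k by
    obtain ⟨H, hH⟩ := h
    exact ⟨H, by rw [← hH]; ring⟩
  rw [coeff_pow_mul_pow hz, Finset.sum_range_succ', Nat.choose_zero_right, Nat.choose_zero_right,
    mul_add]
  simp only [Nat.cast_one, one_mul, Nat.sub_zero, pow_zero, mul_one, add_sub_cancel_right]
  refine Dvd.dvd.mul_left (Finset.dvd_sum fun m hm => ?_) _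
  have hm := Finset.mem_range.mp hm
  refine Dvd.dvd.mul_right (Dvd.dvd.mul_right (Dvd.dvd.mul_left ?_ _) _) _
  exact_mod_cast (Nat.cast_dvd_cast (α := S) (hM (m + 1) (by omega) (by omega)))

end coeff

/-! ### The lowered syzygy and its coefficients modulo p -/

section loweredForm

open Polynomial

variable {S : Type*} [CommRing S]

/-- The coefficient of `σᵏ` in `(z + wσ)²ᵏ⁺¹ f(a(x + uσ), b(y + vσ))`, where `f` is
`betaForm k`. -/
noncomputable def loweredForm (k : ℕ) (u v w x y z a b : S) : S :=
  ((C z + C w * X) ^ (2 * k + 1) *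
    betaForm k (C a * (C x + C u * X)) (C b * (C y + C v * X))).coeff k

/-- The summand of `loweredForm` with exponents `j` and `k - j`. -/
noncomputable def loweredTerm (k : ℕ) (u v w x y z a b : S) (j : ℕ) : S :=
  (-1) ^ j * (((k + j).choose k * (2 * k - j).choose k : ℕ) : S) * a ^ j * b ^ (k - j) *
    ((C z + C w * X) ^ (2 * k + 1) *
      ((C x + C u * X) ^ j * (C y + C v * X) ^ (k - j))).coeff k

theorem loweredForm_eq_sum (k : ℕ) (u v w x y z a b : S) :
    loweredForm k u v w x y z a b =
      ∑ j ∈ Finset.range (k + 1), loweredTerm k u v w x y z a b j := by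
  rw [loweredForm, betaForm, Finset.mul_sum, finsetSum_coeff]
  refine Finset.sum_congr rfl fun j _ => ?_
  rw [loweredTerm, ← coeff_C_mul]
  refine congrArg (fun F : S[X] => F.coeff k) ?_
  generalize C x + C u * X = A
  generalize C y + C v * X = B
  generalize (C z + C w * X) ^ (2 * k + 1) = D
  simp only [map_mul, map_pow, map_natCast, map_neg, map_one, mul_pow]
  ring

theorem loweredForm_eq_add {k : ℕ} (hk : k ≠ 0) (u v w x y z a b : S) :
    loweredForm k u v w x y z a b = loweredTerm k u v w x y z a b 0 +
      loweredTerm k u v w x y z a b k +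
      ∑ j ∈ Finset.Ioo 0 k, loweredTerm k u v w x y z a b j := by
  have h : Finset.range (k + 1) = insert 0 (insert k (Finset.Ioo 0 k)) := by
    ext j
    simp only [Finset.mem_range, Finset.mem_insert, Finset.mem_Ioo]
    omega
  rw [loweredForm_eq_sum, h, Finset.sum_insert (by simp; omega), Finset.sum_insert (by simp),
    add_assoc]

theorem loweredForm_syzygy (k : ℕ) (u v w x y z : S) :
    loweredForm k v w u y z x (w * x - u * z) (u * y - v * x) * (v * z - w * y) ^ (2 * k + 1) +
      loweredForm k w u v z x y (u * y - v * x) (v * z - w * y) * (w * x - u * z) ^ (2 * k + 1) +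
      loweredForm k u v w x y z (v * z - w * y) (w * x - u * z) * (u * y - v * x) ^ (2 * k + 1) =
        0 := by
  have h := betaForm_syzygy (S := S[X]) k
    (a := C (v * z - w * y) * (C x + C u * X)) (b := C (w * x - u * z) * (C y + C v * X))
    (c := C (u * y - v * x) * (C z + C w * X)) (by simp only [map_sub, map_mul]; ring)
  have h' := congrArg (fun P => P.coeff k) h
  simp only [mul_pow, ← C_pow, mul_assoc, coeff_add, coeff_C_mul, coeff_zero] at h'
  simp only [loweredForm]
  linear_combination h'

theorem exists_loweredTerm_add_eq [IsDomain S] {k c q M : ℕ} (hc : (2 * k).choose k = q * c)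
    (hM : ∀ m, 0 < m → m ≤ k → M ∣ (2 * k + 1 + m).choose m) (u v w x y : S) {z : S}
    (hz : z ≠ 0) :
    ∃ H, loweredTerm k u v w x y z (v * z - w * y) (w * x - u * z) 0 +
        loweredTerm k u v w x y z (v * z - w * y) (w * x - u * z) k =
      q * c * (2 * (z ^ (k + 1) * ((v * z - w * y) * (w * x - u * z)) ^ k) + M * H) := by
  obtain ⟨H, hH⟩ := exists_coeff_pow_mul_pow_eq hz y v w hM
  obtain ⟨H', hH'⟩ := exists_coeff_pow_mul_pow_eq hz x u w hM
  refine ⟨(w * x - u * z) ^ k * H + (-1) ^ k * (v * z - w * y) ^ k * H', ?_⟩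
  have hs : (u * z - w * x) ^ k = (-1) ^ k * (w * x - u * z) ^ k := by
    rw [← mul_pow]
    congr 1
    ring
  have h1 : ((-1) ^ k * (-1) ^ k : S) = 1 := by rw [← mul_pow]; simp
  simp only [loweredTerm, Nat.sub_self, Nat.sub_zero, pow_zero, one_mul, mul_one, hH, hH', hs,
    Nat.add_zero, Nat.choose_self, show 2 * k - k = k by omega, ← two_mul, hc, Nat.cast_mul,
    mul_pow]
  linear_combination (q * c * z ^ (k + 1) * (v * z - w * y) ^ k * (w * x - u * z) ^ k : S) * h1

theorem dvd_loweredTerm {k j M : ℕ} (h : M ∣ (k + j).choose k * (2 * k - j).choose k)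
    (u v w x y z a b : S) : (M : S) ∣ loweredTerm k u v w x y z a b j := by
  rw [loweredTerm]
  exact Dvd.dvd.mul_right (Dvd.dvd.mul_right (Dvd.dvd.mul_right
    (Dvd.dvd.mul_left (Nat.cast_dvd_cast h) _) _) _) _

/-- Modulo 2 the first factor is z^(2^a) + w^(2^a) σ^(2^a), while the second has degree below `k`,
so σᵏ falls in a gap. -/
theorem two_dvd_coeff_pow_mul {k a b : ℕ} (hka : k < 2 ^ a) (hb : 2 * b < k) (u v w x y z : S) :
    2 ∣ ((C z + C w * X) ^ 2 ^ a * ((C x + C u * X) ^ b * (C y + C v * X) ^ b)).coeff k := by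
  obtain ⟨r, hr⟩ := exists_add_pow_prime_pow_eq Nat.prime_two (C z) (C w * X) a
  set Q : S[X] := (C x + C u * X) ^ b * (C y + C v * X) ^ b with hQ
  have hdeg : Q.natDegree ≤ 2 * b := by
    have h1 (s t : S) : ((C s + C t * X) ^ b).natDegree ≤ b := by
      refine (natDegree_pow_le_of_le b (m := 1) ?_).trans (by simp)
      rw [add_comm]
      exact natDegree_linear_le
    exact natDegree_mul_le.trans (by have := h1 x u; have := h1 y v; omega)
  have e : (C z + C w * X) ^ 2 ^ a * Q =
      C (z ^ 2 ^ a) * Q + C (w ^ 2 ^ a) * Q * X ^ 2 ^ a + C 2 * (C z * (C w * X) * r * Q) := by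
    rw [hr, mul_pow, map_pow, map_pow]
    simp only [Nat.cast_ofNat, map_ofNat]
    ring
  rw [e, coeff_add, coeff_add, coeff_C_mul, coeff_eq_zero_of_natDegree_lt (by omega),
    coeff_mul_X_pow', if_neg (by omega), coeff_C_mul]
  simp

/-- For `p = 2` these two central terms may each lack a factor 2. They share their binomial product
and have opposite signs, so the missing factor comes from the difference of their coefficients. -/
theorem dvd_loweredTerm_add_loweredTerm {a b k : ℕ} (hk : k + 1 = 2 ^ (a + 1))
    (hb : b + 1 = 2 ^ a) (hb0 : b ≠ 0) (u v w x y z : S) :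
    ((2 ^ (a + 1) * 4 : ℕ) : S) ∣
      loweredTerm k u v w x y z (v * z - w * y) (w * x - u * z) (b + 1) +
        loweredTerm k u v w x y z (v * z - w * y) (w * x - u * z) b := by
  have hkb : k = 2 * b + 1 := by rw [pow_succ] at hk; omega
  have hC : (k + (b + 1)).choose k * (2 * k - (b + 1)).choose k =
      (k + b).choose k * (2 * k - b).choose k := by
    rw [mul_comm, show 2 * k - (b + 1) = k + b by omega, show k + (b + 1) = 2 * k - b by omega]
  have hd := pow_mul_dvd_choose_mul_choose Nat.prime_two (Nat.add_one_ne_zero a) hk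
    (Nat.pos_of_ne_zero hb0) (show b < k by omega)
  obtain ⟨r, hr⟩ := two_dvd_coeff_pow_mul (a := a + 2) (b := b) (k := k)
    (by rw [pow_succ]; omega) (by omega) u v w x y z
  have h2 : 2 * k + 2 = 2 ^ (a + 2) := by rw [pow_succ]; omega
  obtain ⟨t, ht⟩ := hd
  set Q : S[X] := (C x + C u * X) ^ b * (C y + C v * X) ^ b with hQ
  set P : S[X] := C z + C w * X with hP
  -- From d₁(x + uσ) + d₂(y + vσ) = -d₃(z + wσ): the difference is the sum up to an even term, and
  -- the sum raises the exponent of `z + wσ` to a power of 2.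
  have e1 : C (v * z - w * y) * (P ^ (2 * k + 1) * ((C x + C u * X) ^ (b + 1) *
        (C y + C v * X) ^ b)) -
      C (w * x - u * z) * (P ^ (2 * k + 1) * ((C x + C u * X) ^ b * (C y + C v * X) ^ (b + 1))) =
      C (-(u * y - v * x)) * (P ^ 2 ^ (a + 2) * Q) -
        C (2 * (w * x - u * z)) * (P ^ (2 * k + 1) * (Q * (C y + C v * X))) := by
    rw [← h2, pow_succ P (2 * k + 1), pow_succ _ b, pow_succ _ b, hQ, hP]
    simp only [map_sub, map_neg, map_mul, map_ofNat]
    ring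
  have e2 := congrArg (fun F => F.coeff k) e1
  simp only [coeff_sub, coeff_C_mul, hr] at e2
  rw [loweredTerm, loweredTerm, hC, ht, show k - (b + 1) = b by omega,
    show k - b = b + 1 by omega]
  refine ⟨(-1) ^ (b + 1) * t * ((v * z - w * y) * (w * x - u * z)) ^ b * (-(u * y - v * x) * r -
    (w * x - u * z) * (P ^ (2 * k + 1) * (Q * (C y + C v * X))).coeff k), ?_⟩
  push_cast
  rw [mul_pow]
  linear_combination ((-1) ^ (b + 1) * (2 ^ (a + 1) * 2 * t) *
    ((v * z - w * y) ^ b * (w * x - u * z) ^ b) : S) * e2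

theorem dvd_sum_Ioo_loweredTerm {a k : ℕ} (hk : k + 1 = 2 ^ (a + 1)) (u v w x y z : S) :
    ((2 ^ (a + 1) * 4 : ℕ) : S) ∣ ∑ j ∈ Finset.Ioo 0 k,
      loweredTerm k u v w x y z (v * z - w * y) (w * x - u * z) j := by
  obtain ⟨b, hb⟩ : ∃ b, b + 1 = 2 ^ a := ⟨2 ^ a - 1, Nat.sub_add_cancel Nat.one_le_two_pow⟩
  have hkb : k = 2 * b + 1 := by rw [pow_succ] at hk; omega
  rcases eq_or_ne b 0 with hb0 | hb0
  · obtain rfl : k = 1 := by omega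
    rw [show Finset.Ioo 0 1 = ∅ from rfl, Finset.sum_empty]
    exact dvd_zero _
  rw [← Finset.add_sum_erase _ _ (Finset.mem_Ioo.mpr ⟨Nat.succ_pos b, by omega⟩),
    ← Finset.add_sum_erase _ _ (Finset.mem_erase.mpr ⟨(Nat.succ_ne_self b).symm,
      Finset.mem_Ioo.mpr ⟨Nat.pos_of_ne_zero hb0, by omega⟩⟩), ← add_assoc]
  refine dvd_add (dvd_loweredTerm_add_loweredTerm hk hb hb0 u v w x y z)
    (Finset.dvd_sum fun j hj => dvd_loweredTerm ?_ ..)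
  simp only [Finset.mem_erase, Finset.mem_Ioo] at hj
  exact two_pow_mul_four_dvd_choose_mul_choose hk (by omega) (by omega) (by omega) (by omega)

theorem exists_loweredForm_eq [IsDomain S] {p e k : ℕ} (hp : p.Prime) (he : e ≠ 0)
    (hk : k + 1 = p ^ e) :
    ∃ m N : ℕ, m ≠ 0 ∧ ¬ p ∣ N ∧ ∀ u v w x y z : S, z ≠ 0 →
      ∃ H, loweredForm k u v w x y z (v * z - w * y) (w * x - u * z) =
        m * (N * (z ^ (k + 1) * ((v * z - w * y) * (w * x - u * z)) ^ k) + p * H) := by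
  obtain ⟨c, hc, hpc⟩ := exists_choose_two_mul_eq hp he hk
  have hk0 : k ≠ 0 := by
    rintro rfl
    exact (Nat.one_lt_pow he hp.one_lt).ne hk
  rcases hp.eq_two_or_odd' with rfl | hodd
  · obtain ⟨a, rfl⟩ := Nat.exists_eq_add_one_of_ne_zero he
    -- The 2 from the two equal extreme terms must go into `m` to keep `N` odd, hence the
    -- congruences modulo 4.
    refine ⟨2 ^ (a + 1) * 2, c, by positivity, hpc, fun u v w x y z hz => ?_⟩
    obtain ⟨H, hH⟩ := exists_loweredTerm_add_eq hc
      (fun m h h' => four_dvd_choose_two_mul_add hk h h') u v w x y hz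
    obtain ⟨H', hH'⟩ := dvd_sum_Ioo_loweredTerm hk u v w x y z
    refine ⟨c * H + H', ?_⟩
    rw [loweredForm_eq_add hk0, hH, hH']
    push_cast
    ring
  · refine ⟨p ^ e, 2 * c, pow_ne_zero e hp.ne_zero, fun h => ?_, fun u v w x y z hz => ?_⟩
    · rcases (Nat.Prime.dvd_mul hp).mp h with h | h
      · rw [(Nat.prime_dvd_prime_iff_eq hp Nat.prime_two).mp h] at hodd
        exact absurd hodd (by decide)
      · exact hpc h
    obtain ⟨H, hH⟩ := exists_loweredTerm_add_eq hc
      (fun m h h' => prime_dvd_choose_two_mul_add hp hk h h') u v w x y hz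
    obtain ⟨H', hH'⟩ : ((p ^ e * p : ℕ) : S) ∣ ∑ j ∈ Finset.Ioo 0 k,
        loweredTerm k u v w x y z (v * z - w * y) (w * x - u * z) j :=
      Finset.dvd_sum fun j hj => dvd_loweredTerm (pow_mul_dvd_choose_mul_choose hp he hk
        (Finset.mem_Ioo.mp hj).1 (Finset.mem_Ioo.mp hj).2) ..
    refine ⟨c * H + H', ?_⟩
    rw [loweredForm_eq_add hk0, hH, hH']
    push_cast
    ring

end loweredForm

/-! ### The theorem for a single row -/

section frobenius

variable {S : Type*} [CommRing S]

theorem add_mem_span_triple (a b c r s t : S) :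
    r * a + s * b + t * c ∈ Ideal.span ({a, b, c} : Set S) :=
  add_mem (add_mem (Ideal.mul_mem_left _ _ (Ideal.subset_span (by simp)))
    (Ideal.mul_mem_left _ _ (Ideal.subset_span (by simp))))
    (Ideal.mul_mem_left _ _ (Ideal.subset_span (by simp)))

theorem exists_mul_eq_sum_pow {p : ℕ} (hp : p.Prime) (e : ℕ) {a b c : S} (h : a + b + c = 0) :
    ∃ L, (p : S) * L = a ^ p ^ e + b ^ p ^ e + c ^ p ^ e := by
  obtain ⟨r, hr⟩ := exists_add_pow_prime_pow_eq hp a b e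
  obtain ⟨s, hs⟩ := exists_add_pow_prime_pow_eq hp (a + b) c e
  rw [h, zero_pow (pow_ne_zero e hp.ne_zero), hr] at hs
  exact ⟨-(a * b * r) - (a + b) * c * s, by linear_combination hs⟩

theorem exists_mul_eq_sum_row_pow [IsDomain S] [CharZero S] {p e k : ℕ} (hp : p.Prime)
    (he : e ≠ 0) (hk : k + 1 = p ^ e) (u v w : S) {x y z : S} (hx : x ≠ 0) (hy : y ≠ 0)
    (hz : z ≠ 0) :
    ∃ L : S, p * L = (x * (v * z - w * y)) ^ (k + 1) + (y * (w * x - u * z)) ^ (k + 1) +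
        (z * (u * y - v * x)) ^ (k + 1) ∧
      L * ((v * z - w * y) * (w * x - u * z) * (u * y - v * x)) ^ k ∈
        Ideal.span ({(v * z - w * y) ^ (2 * k + 1), (w * x - u * z) ^ (2 * k + 1),
          (u * y - v * x) ^ (2 * k + 1)} : Set S) := by
  obtain ⟨L, hL⟩ := exists_mul_eq_sum_pow hp e
    (show x * (v * z - w * y) + y * (w * x - u * z) + z * (u * y - v * x) = 0 by ring)
  rw [← hk] at hL
  refine ⟨L, hL, ?_⟩
  obtain ⟨m, N, hm, hpN, hG⟩ := exists_loweredForm_eq (S := S) hp he hk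
  obtain ⟨H₁, h₁⟩ := hG v w u y z x hx
  obtain ⟨H₂, h₂⟩ := hG w u v z x y hy
  obtain ⟨H₃, h₃⟩ := hG u v w x y z hz
  have hs := loweredForm_syzygy k u v w x y z
  rw [h₁, h₂, h₃] at hs
  generalize v * z - w * y = d₁ at *
  generalize w * x - u * z = d₂ at *
  generalize u * y - v * x = d₃ at *
  have hs' : (N : S) * (x ^ (k + 1) * (d₂ * d₃) ^ k * d₁ ^ (2 * k + 1) +
      y ^ (k + 1) * (d₃ * d₁) ^ k * d₂ ^ (2 * k + 1) +
      z ^ (k + 1) * (d₁ * d₂) ^ k * d₃ ^ (2 * k + 1)) +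
      p * (H₁ * d₁ ^ (2 * k + 1) + H₂ * d₂ ^ (2 * k + 1) + H₃ * d₃ ^ (2 * k + 1)) = 0 := by
    refine (mul_eq_zero.mp (?_ : (m : S) * _ = 0)).resolve_left (Nat.cast_ne_zero.mpr hm)
    linear_combination hs
  have hsum : p * L * (d₁ * d₂ * d₃) ^ k = x ^ (k + 1) * (d₂ * d₃) ^ k * d₁ ^ (2 * k + 1) +
      y ^ (k + 1) * (d₃ * d₁) ^ k * d₂ ^ (2 * k + 1) +
      z ^ (k + 1) * (d₁ * d₂) ^ k * d₃ ^ (2 * k + 1) := by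
    rw [hL]
    simp only [mul_pow]
    ring
  -- Comparing the syzygy with the expansion of `p * L` leaves a common factor `p`; a Bézout
  -- relation between `p` and `N` then isolates `L`.
  have hN : N * L * (d₁ * d₂ * d₃) ^ k =
      -(H₁ * d₁ ^ (2 * k + 1) + H₂ * d₂ ^ (2 * k + 1) + H₃ * d₃ ^ (2 * k + 1)) := by
    refine mul_left_cancel₀ (Nat.cast_ne_zero.mpr hp.ne_zero : (p : S) ≠ 0) ?_
    linear_combination (N : S) * hsum + hs'
  obtain ⟨a, b, hab⟩ : IsCoprime (p : ℤ) N :=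
    Nat.isCoprime_iff_coprime.mpr ((hp.coprime_iff_not_dvd).mpr hpN)
  have hab' := congrArg (Int.cast (R := S)) hab
  push_cast at hab'
  have : L * (d₁ * d₂ * d₃) ^ k =
      a * (p * L * (d₁ * d₂ * d₃) ^ k) + b * (N * L * (d₁ * d₂ * d₃) ^ k) := by
    linear_combination -(L * (d₁ * d₂ * d₃) ^ k) * hab'
  rw [this, hsum, hN]
  exact add_mem (Ideal.mul_mem_left _ _ (add_mem_span_triple _ _ _ _ _ _))
    (Ideal.mul_mem_left _ _ (neg_mem (add_mem_span_triple _ _ _ _ _ _)))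

end frobenius

/-! ### Syzygies of the minors, and the general case -/

namespace PluckerMinors

theorem irreducible_Δ₃ : Irreducible Δ₃ := by
  have h : Δ₃ = MvPolynomial.X 0 * MvPolynomial.X 4 + -(MvPolynomial.X 1 * MvPolynomial.X 3) := by
    rw [Δ₃, u, v, x, y, sub_eq_add_neg]
  rw [h]
  refine MvPolynomial.irreducible_mul_X_add _ _ 4 (MvPolynomial.X_ne_zero _) (by simp) ?_ ?_
  · rw [MvPolynomial.vars_neg]
    intro h4
    have := MvPolynomial.vars_mul _ _ h4
    simp at this
  · refine ((MvPolynomial.X_prime (i := 0)).irreducible.isRelPrime_iff_not_dvd).mpr ?_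
    rintro ⟨r, hr⟩
    have := congrArg (MvPolynomial.eval (fun i : Fin 6 => if i = 0 then (0 : ℤ) else 1)) hr
    simp at this

theorem not_Δ₃_dvd_Δ₁ : ¬ Δ₃ ∣ Δ₁ := by
  rintro ⟨r, hr⟩
  have := congrArg (MvPolynomial.eval (fun i : Fin 6 => if i = 1 ∨ i = 5 then (1 : ℤ) else 0)) hr
  simp [Δ₁, Δ₃, u, v, w, x, y, z] at this

/-- The syzygies of the three minors are generated by the rows of the matrix. -/
theorem exists_eq_of_syzygy {F₁ F₂ F₃ : R} (hF : F₁ * Δ₁ + F₂ * Δ₂ + F₃ * Δ₃ = 0) :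
    ∃ f g : R, F₁ = f * u + g * x ∧ F₂ = f * v + g * y ∧ F₃ = f * w + g * z := by
  have hΔ : Prime Δ₃ := irreducible_Δ₃.prime
  -- Cramer's rule on the first two columns gives `f` and `g` with denominator `Δ₃`; this primality
  -- argument clears it.
  have hdvd {s t : R} (h : s * Δ₁ = Δ₃ * t) : ∃ r, s = Δ₃ * r :=
    (hΔ.dvd_or_dvd ⟨t, h⟩).resolve_right not_Δ₃_dvd_Δ₁
  obtain ⟨f, hf⟩ := hdvd (s := F₁ * y - F₂ * x) (t := F₂ * z - F₃ * y) (by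
    simp only [Δ₁, Δ₂, Δ₃] at hF ⊢
    linear_combination y * hF)
  obtain ⟨g, hg⟩ := hdvd (s := u * F₂ - v * F₁) (t := v * F₃ - w * F₂) (by
    simp only [Δ₁, Δ₂, Δ₃] at hF ⊢
    linear_combination (-v) * hF)
  have h₁ : F₁ = f * u + g * x := mul_left_cancel₀ hΔ.ne_zero (by
    simp only [Δ₃] at *
    linear_combination u * hf + x * hg)
  have h₂ : F₂ = f * v + g * y := mul_left_cancel₀ hΔ.ne_zero (by
    simp only [Δ₃] at *
    linear_combination v * hf + y * hg)
  refine ⟨f, g, h₁, h₂, mul_left_cancel₀ hΔ.ne_zero ?_⟩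
  rw [h₁, h₂] at hF
  simp only [Δ₁, Δ₂, Δ₃] at *
  linear_combination hF

end PluckerMinors

open PluckerMinors in
/-- The polynomial `L` is the quotient `((F₁Δ₁)^q + (F₂Δ₂)^q + (F₃Δ₃)^q) / p`: its existence says
that `p` divides the sum, and it is unique because `ℤ[u, v, w, x, y, z]` has no `p`-torsion. -/
theorem theorem3p1 (F₁ F₂ F₃ : PluckerMinors.R)
    (hF : F₁ * PluckerMinors.Δ₁ + F₂ * PluckerMinors.Δ₂ + F₃ * PluckerMinors.Δ₃ = 0)
    (p e q k : ℕ) (hp : p.Prime) (hq : q = p ^ e) (hk : k = q - 1) :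
    ∃ L : PluckerMinors.R,
      (p : PluckerMinors.R) * L =
        (F₁ * PluckerMinors.Δ₁) ^ q + (F₂ * PluckerMinors.Δ₂) ^ q
          + (F₃ * PluckerMinors.Δ₃) ^ q ∧
      L * (PluckerMinors.Δ₁ * PluckerMinors.Δ₂ * PluckerMinors.Δ₃) ^ k ∈
        Ideal.span ({PluckerMinors.Δ₁ ^ (q + k), PluckerMinors.Δ₂ ^ (q + k),
          PluckerMinors.Δ₃ ^ (q + k)} : Set PluckerMinors.R) := by
  rcases eq_or_ne e 0 with rfl | he
  · rw [pow_zero] at hq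
    subst hq
    exact ⟨0, by simp [hF], by simp⟩
  obtain rfl : q = k + 1 := by
    have := hq ▸ pow_pos hp.pos e
    omega
  have hX (i : Fin 6) : (MvPolynomial.X i : R) ≠ 0 := MvPolynomial.X_ne_zero i
  obtain ⟨f, g, rfl, rfl, rfl⟩ := exists_eq_of_syzygy hF
  obtain ⟨L, hL, hLI⟩ := exists_mul_eq_sum_row_pow hp he hq u v w (hX 3) (hX 4) (hX 5)
  -- Exchanging the rows with a sign leaves all three minors unchanged.
  obtain ⟨K, hK, hKI⟩ := exists_mul_eq_sum_row_pow hp he hq (-x) (-y) (-z) (hX 0) (hX 1) (hX 2)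
  rw [← x.eq_def, ← y.eq_def, ← z.eq_def, ← Δ₁.eq_def, ← Δ₂.eq_def, ← Δ₃.eq_def] at hL hLI
  have e₁ : -y * w - -z * v = Δ₁ := by rw [Δ₁]; ring
  have e₂ : -z * u - -x * w = Δ₂ := by rw [Δ₂]; ring
  have e₃ : -x * v - -y * u = Δ₃ := by rw [Δ₃]; ring
  rw [← u.eq_def, ← v.eq_def, ← w.eq_def, e₁, e₂, e₃] at hK hKI
  obtain ⟨r₁, h₁⟩ := exists_add_pow_prime_pow_eq hp (f * u) (g * x) e
  obtain ⟨r₂, h₂⟩ := exists_add_pow_prime_pow_eq hp (f * v) (g * y) e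
  obtain ⟨r₃, h₃⟩ := exists_add_pow_prime_pow_eq hp (f * w) (g * z) e
  rw [← hq] at h₁ h₂ h₃
  generalize Δ₁ = d₁ at *
  generalize Δ₂ = d₂ at *
  generalize Δ₃ = d₃ at *
  -- The last three summands are the mixed terms divided by `p`; each contains some dᵢ^(k+1), which
  -- the factor dᵢ^k completes to dᵢ^(2k+1).
  refine ⟨f ^ (k + 1) * K + g ^ (k + 1) * L + (f * u * (g * x) * r₁ * d₁ ^ (k + 1) +
    f * v * (g * y) * r₂ * d₂ ^ (k + 1) + f * w * (g * z) * r₃ * d₃ ^ (k + 1)), ?_, ?_⟩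
  · rw [mul_pow _ d₁, mul_pow _ d₂, mul_pow _ d₃, h₁, h₂, h₃]
    simp only [mul_pow _ d₁, mul_pow _ d₂, mul_pow _ d₃] at hK hL
    rw [mul_pow f, mul_pow f, mul_pow f, mul_pow g, mul_pow g, mul_pow g]
    linear_combination f ^ (k + 1) * hK + g ^ (k + 1) * hL
  · have e : (f ^ (k + 1) * K + g ^ (k + 1) * L + (f * u * (g * x) * r₁ * d₁ ^ (k + 1) +
        f * v * (g * y) * r₂ * d₂ ^ (k + 1) + f * w * (g * z) * r₃ * d₃ ^ (k + 1))) *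
          (d₁ * d₂ * d₃) ^ k =
        f ^ (k + 1) * (K * (d₁ * d₂ * d₃) ^ k) + g ^ (k + 1) * (L * (d₁ * d₂ * d₃) ^ k) +
        (f * u * (g * x) * r₁ * (d₂ * d₃) ^ k * d₁ ^ (2 * k + 1) +
        f * v * (g * y) * r₂ * (d₁ * d₃) ^ k * d₂ ^ (2 * k + 1) +
        f * w * (g * z) * r₃ * (d₁ * d₂) ^ k * d₃ ^ (2 * k + 1)) := by
      simp only [mul_pow d₁, mul_pow d₂, mul_pow (d₁ * d₂)]
      ring
    rw [e, show k + 1 + k = 2 * k + 1 by ring]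
    exact Ideal.add_mem _ (Ideal.add_mem _ (Ideal.mul_mem_left _ _ hKI)
      (Ideal.mul_mem_left _ _ hLI)) (add_mem_span_triple _ _ _ _ _ _)
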